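/- Let $q\ge 5$ be an integer. The hyperbolic Pascal triangle of the mosaic $\{4,q\}$ is built row by row from vertices that carry a type (winger, $A$ or $B$) and a positive integer value. Row $0$ is a single base vertex of value $1$, which has two descendants. A winger has $2$ descendants, a vertex of type $A$ has $q-2$, and a vertex of type $B$ has $q-1$. Each row is obtained from the previous one by drawing these descendant edges from left to right: the last edge of a vertex and the first edge of its right neighbour meet in a vertex of type $A$, whose value is the sum of the values of its two ascendants. Every other descendant inherits the value of its unique ascendant; the leftmost and the rightmost vertex of the new row are wingers, and the remaining ones have type $B$. Let $s_n$ be the number of vertices of row $n$, let $h_{n,i}$ denote the value of the $i$-th vertex of row $n$ ($0\le i\le s_n-1$), and put $$(s^k)_n=\sum_{i=0}^{s_n-1}h_{n,i}^{\,k}.$$ For each $k$ with $0\le k\le 11$ let $d=\lfloor k/2\rfloor+3$ and let $c_1(q),\dots,c_d(q)$ be the following polynomials of degree at most $1$ in $q$ with integer coefficients, which do not depend on $n$: - $k=0$: $q-1,\; -q+1,\; 1$ - $k=1$: $q,\; -q-1,\; 2$ - $k=2$: $q+2,\; -q-7,\; 8,\; -2$ - $k=3$: $q+4,\; q-19,\;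 -2q+18,\; -2$ - $k=4$: $q+7,\; 6q-41,\; -7q+31,\; 6,\; -2$ - $k=5$: $q+11,\; 18q-71,\; -9q-17,\; -10q+88,\; -10$ - $k=6$: $q+17,\; 44q-99,\; 17q-303,\; -62q+404,\; -14,\; -4$ - $k=7$: $q+26,\; 99q-68,\; 177q-1400,\; -235q+1183,\; -42q+302,\; -42$ - $k=8$: $q+40,\; 213q+206,\; 757q-4842,\; -717q+2981,\; -254q+1782,\; -162,\; -4$ - $k=9$: $q+62,\; 447q+1288,\; 2433q-15116,\; -2431q+10555,\; -450q+3662,\; -450,\; 0$ - $k=10$: $q+97,\; 924q+4782,\; 6096q-48560,\; -13946q+75623,\; 5903q-24351,\; 1022q-8408,\; 814,\; 4$ - $k=11$: $q+153,\; 1892q+15110,\; 9924q-181164,\; -99514q+592503,\; 78523q-360899,\; 9174q-74876,\; 9174,\; 0$ Then, for all integers $q\ge5$, all $k$ with $0\le k\le 11$ and all $n\ge d$, $$(s^k)_n=\sum_{j=1}^{d}c_j(q)\,(s^k)_{n-j}.$$ The last coefficient $c_d$ is the zero polynomial exactly for $k=9$ and $k=11$; thus the recurrence has order $d=\lfloor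 k/2\rfloor+3$, where for $k=9$ and $k=11$ the tabulated trailing zero coefficient is counted. -/

import Mathlib

open Polynomial

namespace HyperbolicPascal

/-- The three kinds of vertices of the hyperbolic Pascal triangle of the mosaic with Schläfli
symbol {4, q}. The base vertex (the only vertex of row 0) is counted as a winger: it has two
descendants and value 1. -/
inductive VertexType where
  | winger
  | A
  | B

/-- A vertex of a row: its type, and its value (the number of shortest paths from the base vertex,
which is the sum of the values of its ascendants in the previous row). -/
structure Vertex where
  type : VertexType
  value : ℕ

/-- The number of descendants (edges drawn downwards) of a vertex. -/
def numDescendants (q : ℕ) : VertexType → ℕ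
  | .winger => 2
  | .A => q - 2
  | .B => q - 1

/-- All descendants of the consecutive vertices `v :: l` (the end of a row), from left to right,
except for the leftmost descendant of `v`. The last edge of a vertex and the first edge of its right
neighbour meet in a vertex of type A, whose value is the sum of the values of its two ascendants.
The descendants of a vertex strictly between its first and its last one have type B, and the
rightmost descendant of the last vertex of the row is a winger; these have one ascendant and
inherit its value. -/
def descendantsFrom (q : ℕ) : Vertex → List Vertex → List Vertex
  | v, [] =>
      List.replicate (numDescendants q v.type - 2) ⟨.B, v.value⟩ ++ [⟨.winger, v.value⟩]
  | v, w :: l =>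
      List.replicate (numDescendants q v.type - 2) ⟨.B, v.value⟩ ++
        ⟨.A, v.value + w.value⟩ :: descendantsFrom q w l

/-- The row below a given row: the leftmost descendant of the leftmost vertex is a winger, and
the other descendants follow. -/
def nextRow (q : ℕ) : List Vertex → List Vertex
  | [] => []
  | v :: l => ⟨.winger, v.value⟩ :: descendantsFrom q v l

/-- Row `n` of the hyperbolic Pascal triangle of {4, q}, from left to right. -/
def row (q : ℕ) : ℕ → List Vertex
  | 0 => [⟨.winger, 1⟩]
  | n + 1 => nextRow q (row q n)

/-- The number `s_n` of vertices of row `n`. -/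
def rowSize (q n : ℕ) : ℕ := (row q n).length

/-- The value of the element with index `i` (counted from 0) of row `n`. -/
def hbinom (q n i : ℕ) : ℕ := ((row q n).map Vertex.value).getD i 0

/-- The power sum `(s^k)_n`, the sum of the `k`-th powers of the elements of row `n`. -/
def powerSum (q k n : ℕ) : ℕ := ∑ i ∈ Finset.range (rowSize q n), hbinom q n i ^ k

/-- The table of coefficients: the entry for `k` lists the polynomials `c_1, c_2, …` in the
indeterminate `X` (which stands for `q`). -/
noncomputable def coeffTable : ℕ → List ℤ[X]
  | 0 => [X - 1, -X + 1, 1]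
  | 1 => [X, -X - 1, 2]
  | 2 => [X + 2, -X - 7, 8, -2]
  | 3 => [X + 4, X - 19, -2 * X + 18, -2]
  | 4 => [X + 7, 6 * X - 41, -7 * X + 31, 6, -2]
  | 5 => [X + 11, 18 * X - 71, -9 * X - 17, -10 * X + 88, -10]
  | 6 => [X + 17, 44 * X - 99, 17 * X - 303, -62 * X + 404, -14, -4]
  | 7 => [X + 26, 99 * X - 68, 177 * X - 1400, -235 * X + 1183, -42 * X + 302, -42]
  | 8 => [X + 40, 213 * X + 206, 757 * X - 4842, -717 * X + 2981, -254 * X + 1782, -162, -4]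
  | 9 => [X + 62, 447 * X + 1288, 2433 * X - 15116, -2431 * X + 10555, -450 * X + 3662, -450, 0]
  | 10 => [X + 97, 924 * X + 4782, 6096 * X - 48560, -13946 * X + 75623, 5903 * X - 24351,
      1022 * X - 8408, 814, 4]
  | 11 => [X + 153, 1892 * X + 15110, 9924 * X - 181164, -99514 * X + 592503,
      78523 * X - 360899, 9174 * X - 74876, 9174, 0]
  | _ => []

/-- The tabulated coefficient `c_j` for the exponent `k`, where `j` is counted from 1. -/
noncomputable def tableCoeff (k j : ℕ) : ℤ[X] := (coeffTable k).getD (j - 1) 0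

end HyperbolicPascal

/-!
A recurrence for the `k`-th power sums comes from following sums over neighbours. For a row of
values `h_0, h_1, …` and a symmetric binary form `f` of degree `k`, let `P_f` be the sum of
`f (h_i, h_{i+1})` over all pairs of neighbours, let `s` be the power sum of the row, and let `a`
be the part of it coming from the vertices of type `A`. Between the children of two neighbours
with values `x` and `y` there is a single vertex of type `A`, with value `x + y`. The
neighbouring pair `(x, y)` is therefore replaced by `(x, x + y)` and `(x + y, y)`, and the only
other new pairs are the pairs `(x, x)` of `B`-children of the same vertex: `q - 5` of them below
a vertex of type `A`, `q - 4` below one of type `B`, none below a winger. Writing primes for the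
next row and `T f (x, y) = f (x, x + y) + f (x + y, y)`, this gives

* `a' = P_g` for `g = (x + y) ^ k`,
* `P_f' = P_{T f} + f (1, 1) * ((q - 4) * (s - 2) - a)` (`adjacentSum_row_succ`),
* `P_e = 2 * s - 2` for `e = x ^ k + y ^ k`, because both wingers have value `1`.

Write the tabulated coefficients as `c_j = u_j * q + v_j`. Start from the form `e` and, at step
`j`, replace the current form `f` by `T f - 2 * u_{j-1} * g - (v_j + 4 * u_j) * e`, where `u_0 = 0`.
As long as `f (1, 1) = 2 * u_j` holds at every step, the three identities telescope
(`adjacentSum_telescope`), and the power sums satisfy the recurrence as soon as the last form is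
zero and the constants cancel, that is, `∑ u_j = 0` and `∑ v_j = 1`. Each step is free of `q`, so
what remains is a finite computation with integers for each `k` (`terminates_coeffPairs`); a form of
degree `k` is recognised as zero by its values at `k + 1` points (`eq_zero_of_mem_binaryForms`).

The step below row `0` is exceptional, since its only vertex is both the leftmost and the rightmost
one. The formula for `P_f'` holds there when `f (1, 1) = 0`, which is the case for the last form
used, because `u_d = 0`.
-/

namespace HyperbolicPascal

/-! ### Binary forms -/

/-- The operator `T` on functions of two variables that describes how neighbouring pairs split:
`(x, y)` is replaced by `(x, x + y)` and `(x + y, y)`. -/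
def splitForm (f : ℤ → ℤ → ℤ) (x y : ℤ) : ℤ := f x (x + y) + f (x + y) y

/-- Binary forms of degree `k`, as integer functions: the span of the `k`-th powers of linear
forms. -/
def binaryForms (k : ℕ) : Submodule ℤ (ℤ → ℤ → ℤ) :=
  Submodule.span ℤ (Set.range fun c : ℤ × ℤ => fun x y => (c.1 * x + c.2 * y) ^ k)

theorem linear_pow_mem_binaryForms (k : ℕ) (a b : ℤ) :
    (fun x y => (a * x + b * y) ^ k) ∈ binaryForms k :=
  Submodule.subset_span ⟨(a, b), rfl⟩

theorem endForm_mem_binaryForms (k : ℕ) : (fun x y => x ^ k + y ^ k) ∈ binaryForms k := by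
  have h := add_mem (linear_pow_mem_binaryForms k 1 0) (linear_pow_mem_binaryForms k 0 1)
  convert h using 3 with x y
  simp

theorem sum_pow_mem_binaryForms (k : ℕ) : (fun x y => (x + y) ^ k) ∈ binaryForms k := by
  simpa using linear_pow_mem_binaryForms k 1 1

theorem splitForm_mem_binaryForms {k : ℕ} {f : ℤ → ℤ → ℤ} (hf : f ∈ binaryForms k) :
    splitForm f ∈ binaryForms k := by
  induction hf using Submodule.span_induction with
  | mem f hf =>
    obtain ⟨⟨a, b⟩, rfl⟩ := hf
    convert add_mem (linear_pow_mem_binaryForms k (a + b) b)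
      (linear_pow_mem_binaryForms k a (a + b)) using 1
    ext x y
    simp only [splitForm, Pi.add_apply]
    ring
  | zero => exact zero_mem _
  | add f g _ _ hf hg =>
    convert add_mem hf hg using 1
    ext x y
    simp only [splitForm, Pi.add_apply]
    ring
  | smul c f _ hf =>
    convert Submodule.smul_mem _ c hf using 1
    ext x y
    simp only [splitForm, Pi.smul_apply, smul_eq_mul]
    ring

theorem apply_self_of_mem_binaryForms {k : ℕ} {f : ℤ → ℤ → ℤ} (hf : f ∈ binaryForms k) (x : ℤ) :
    f x x = f 1 1 * x ^ k := by
  induction hf using Submodule.span_induction with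
  | mem f hf =>
    obtain ⟨⟨a, b⟩, rfl⟩ := hf
    simp only [← mul_pow]
    ring
  | zero => simp
  | add f g _ _ hf hg => simp only [Pi.add_apply, hf, hg, add_mul]
  | smul c f _ hf => simp only [Pi.smul_apply, smul_eq_mul, hf, mul_assoc]

theorem exists_coeff_of_mem_binaryForms {k : ℕ} {f : ℤ → ℤ → ℤ} (hf : f ∈ binaryForms k) :
    ∃ c : ℕ → ℤ, ∀ x y, f x y = ∑ j ∈ Finset.range (k + 1), c j * (x ^ j * y ^ (k - j)) := by
  induction hf using Submodule.span_induction with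
  | mem f hf =>
    obtain ⟨⟨a, b⟩, rfl⟩ := hf
    refine ⟨fun j => a ^ j * b ^ (k - j) * k.choose j, fun x y => ?_⟩
    simp only [add_pow, mul_pow]
    exact Finset.sum_congr rfl fun j _ => by ring
  | zero => exact ⟨0, by simp⟩
  | add f g _ _ hf hg =>
    obtain ⟨c, hc⟩ := hf
    obtain ⟨d, hd⟩ := hg
    exact ⟨c + d, fun x y => by simp [hc, hd, add_mul, Finset.sum_add_distrib]⟩
  | smul a f _ hf =>
    obtain ⟨c, hc⟩ := hf
    exact ⟨a • c, fun x y => by simp [hc, Finset.mul_sum, mul_assoc]⟩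

/-- A binary form of degree `k` with `k + 1` zeros `(j, 1)` is zero, since the polynomial
`f (X, 1)` has degree at most `k`. -/
theorem eq_zero_of_mem_binaryForms {k : ℕ} {f : ℤ → ℤ → ℤ} (hf : f ∈ binaryForms k)
    (h : ∀ j < k + 1, f j 1 = 0) (x y : ℤ) : f x y = 0 := by
  obtain ⟨c, hc⟩ := exists_coeff_of_mem_binaryForms hf
  let p : ℤ[X] := ∑ j ∈ Finset.range (k + 1), C (c j) * X ^ j
  have hp : p = 0 := by
    refine Polynomial.eq_zero_of_natDegree_lt_card_of_eval_eq_zero' p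
      ((Finset.range (k + 1)).map Nat.castEmbedding) ?_ ?_
    · intro z hz
      obtain ⟨j, hj, rfl⟩ := Finset.mem_map.1 hz
      simpa [p, Polynomial.eval_finsetSum, hc] using h j (Finset.mem_range.1 hj)
    · rw [Finset.card_map, Finset.card_range, Nat.lt_succ_iff]
      exact Polynomial.natDegree_sum_le_of_forall_le _ _ fun j hj =>
        (Polynomial.natDegree_C_mul_X_pow_le _ _).trans (Nat.lt_succ_iff.1 (Finset.mem_range.1 hj))
  rw [hc]
  refine Finset.sum_eq_zero fun j hj => ?_
  have hcj : p.coeff j = c j := by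
    simp only [p, Polynomial.finsetSum_coeff, Polynomial.coeff_C_mul_X_pow]
    rw [Finset.sum_ite_eq, if_pos hj]
  rw [← hcj, hp, Polynomial.coeff_zero, zero_mul]

/-! ### Sums over a row -/

/-- The sum of `f (x_i, x_{i+1})` over the pairs of neighbours in a row with values
`x, x_1, x_2, …`, where `x_1, x_2, …` are the values of the vertices of the list. -/
def adjacentSumFrom (f : ℤ → ℤ → ℤ) : ℕ → List Vertex → ℤ
  | _, [] => 0
  | x, w :: l => f x w.value + adjacentSumFrom f w.value l

/-- The sum of `f (x, y)` over the pairs of values of neighbours in a row. -/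
def adjacentSum (f : ℤ → ℤ → ℤ) : List Vertex → ℤ
  | [] => 0
  | v :: l => adjacentSumFrom f v.value l

/-- The sum of the `k`-th powers of the values. -/
def valueSum (k : ℕ) (l : List Vertex) : ℤ := (l.map fun v => (v.value : ℤ) ^ k).sum

/-- The sum of the `k`-th powers of the values of the vertices of type `A`. -/
def valueSumA (k : ℕ) : List Vertex → ℤ
  | [] => 0
  | ⟨.A, x⟩ :: l => (x : ℤ) ^ k + valueSumA k l
  | _ :: l => valueSumA k l

/-- A nonempty end piece of a row: the last vertex, and only this one, is a winger, and it has
value `1`. -/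
def IsRowEnd : List Vertex → Prop
  | [] => False
  | [v] => v = ⟨.winger, 1⟩
  | v :: w :: l => v.type ≠ .winger ∧ IsRowEnd (w :: l)

theorem adjacentSumFrom_replicate_append (f : ℤ → ℤ → ℤ) (t : VertexType) (x c : ℕ)
    (l : List Vertex) :
    adjacentSumFrom f x (List.replicate c ⟨t, x⟩ ++ l) =
      c * f x x + adjacentSumFrom f x l := by
  induction c with
  | zero => simp
  | succ c ih =>
    rw [List.replicate_succ, List.cons_append, adjacentSumFrom, ih]
    push_cast
    ring

theorem valueSumA_replicate_B_append (k x c : ℕ) (l : List Vertex) :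
    valueSumA k (List.replicate c ⟨.B, x⟩ ++ l) = valueSumA k l := by
  induction c with
  | zero => simp
  | succ c ih => rw [List.replicate_succ, List.cons_append, valueSumA, ih]; simp

theorem IsRowEnd.cons {v : Vertex} {l : List Vertex} (hv : v.type ≠ .winger) (hl : IsRowEnd l) :
    IsRowEnd (v :: l) := by
  cases l with
  | nil => exact hl.elim
  | cons w l => exact ⟨hv, hl⟩

theorem isRowEnd_replicate_B_append (x c : ℕ) {l : List Vertex} (hl : IsRowEnd l) :
    IsRowEnd (List.replicate c ⟨.B, x⟩ ++ l) := by
  induction c with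
  | zero => simpa
  | succ c ih =>
    rw [List.replicate_succ, List.cons_append]
    exact ih.cons (by simp)

theorem isRowEnd_descendantsFrom (q : ℕ) (v : Vertex) (l : List Vertex)
    (h : IsRowEnd (v :: l)) : IsRowEnd (descendantsFrom q v l) := by
  induction l generalizing v with
  | nil =>
    refine isRowEnd_replicate_B_append _ _ ?_
    obtain rfl : v = ⟨.winger, 1⟩ := h
    rfl
  | cons w l ih =>
    exact isRowEnd_replicate_B_append _ _ ((ih w h.2).cons (by simp))

theorem valueSumA_descendantsFrom (q k : ℕ) (v : Vertex) (l : List Vertex) :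
    valueSumA k (descendantsFrom q v l) =
      adjacentSumFrom (fun x y => (x + y) ^ k) v.value l := by
  induction l generalizing v with
  | nil => rw [descendantsFrom, valueSumA_replicate_B_append]; simp [valueSumA, adjacentSumFrom]
  | cons w l ih =>
    rw [descendantsFrom, valueSumA_replicate_B_append, valueSumA, ih, adjacentSumFrom]
    push_cast
    rfl

theorem adjacentSumFrom_endForm (k x : ℕ) (l : List Vertex) (h : IsRowEnd l) :
    adjacentSumFrom (fun x y => x ^ k + y ^ k) x l = x ^ k + 2 * valueSum k l - 1 := by
  induction l generalizing x with
  | nil => exact h.elim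
  | cons v l ih =>
    cases l with
    | nil =>
      obtain rfl : v = ⟨.winger, 1⟩ := h
      simp [adjacentSumFrom, valueSum]
      ring
    | cons w l =>
      rw [adjacentSumFrom, ih _ h.2]
      simp only [valueSum, List.map_cons, List.sum_cons]
      ring

/-- The pairs of neighbours in the end piece of a row that descends from an end piece of the
previous row. The value `x` is that of the vertex to the left of the new piece. -/
theorem adjacentSumFrom_descendantsFrom {q k : ℕ} (hq : 5 ≤ q) {f : ℤ → ℤ → ℤ}
    (hf : ∀ x, f x x = f 1 1 * x ^ k) (x : ℕ) (v : Vertex) (l : List Vertex)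
    (h : IsRowEnd (v :: l)) :
    adjacentSumFrom f x (descendantsFrom q v l) =
      f x v.value + adjacentSumFrom (splitForm f) v.value l +
        f 1 1 * ((q - 4) * (valueSum k (v :: l) - 1) - valueSumA k (v :: l)) := by
  induction l generalizing x v with
  | nil =>
    obtain rfl : v = ⟨.winger, 1⟩ := h
    simp [descendantsFrom, numDescendants, adjacentSumFrom, valueSum, valueSumA]
  | cons w l ih =>
    -- An inner vertex has at least one child of type `B`, the right neighbour of `x`.
    obtain ⟨c, hc⟩ : ∃ c, numDescendants q v.type - 2 = c + 1 := by
      refine Nat.exists_eq_succ_of_ne_zero ?_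
      obtain ⟨t, z⟩ := v
      cases t with
      | winger => exact absurd rfl h.1
      | A => simp only [numDescendants]; omega
      | B => simp only [numDescendants]; omega
    have hmult : f 1 1 * ((q - 4) * (v.value : ℤ) ^ k) +
        f 1 1 * (valueSumA k (w :: l) - valueSumA k (v :: w :: l)) =
          c * (f 1 1 * (v.value : ℤ) ^ k) := by
      obtain ⟨t, z⟩ := v
      cases t with
      | winger => exact absurd rfl h.1
      | A =>
        have : (c : ℤ) = q - 5 := by simp only [numDescendants] at hc; omega
        simp only [valueSumA, this]
        ring
      | B =>
        have : (c : ℤ) = q - 4 := by simp only [numDescendants] at hc; omega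
        have ha : valueSumA k (⟨.B, z⟩ :: w :: l) = valueSumA k (w :: l) := rfl
        rw [ha, this]
        ring
    rw [descendantsFrom, hc, List.replicate_succ, List.cons_append, adjacentSumFrom,
      adjacentSumFrom_replicate_append, adjacentSumFrom, ih _ _ h.2, hf]
    have hs : valueSum k (v :: w :: l) = (v.value : ℤ) ^ k + valueSum k (w :: l) := by
      simp [valueSum]
    rw [hs, adjacentSumFrom, splitForm]
    push_cast
    linear_combination -hmult

/-! ### The step from row to row -/

theorem exists_row_succ_eq (q n : ℕ) :
    ∃ l, row q (n + 1) = ⟨.winger, 1⟩ :: l ∧ IsRowEnd l := by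
  induction n with
  | zero =>
    exact ⟨[⟨.winger, 1⟩], by simp [row, nextRow, descendantsFrom, numDescendants], rfl⟩
  | succ n ih =>
    obtain ⟨l, hl, h⟩ := ih
    rw [row, hl]
    cases l with
    | nil => exact h.elim
    | cons w l =>
      exact ⟨_, rfl, (isRowEnd_descendantsFrom q w l h).cons (by simp)⟩

theorem adjacentSum_endForm (q k n : ℕ) :
    adjacentSum (fun x y => x ^ k + y ^ k) (row q n) = 2 * valueSum k (row q n) - 2 := by
  cases n with
  | zero => simp [row, adjacentSum, adjacentSumFrom, valueSum]
  | succ n =>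
    obtain ⟨l, hl, h⟩ := exists_row_succ_eq q n
    rw [hl, adjacentSum, adjacentSumFrom_endForm _ _ _ h]
    simp [valueSum]
    ring

theorem valueSumA_row_succ (q k n : ℕ) :
    valueSumA k (row q (n + 1)) = adjacentSum (fun x y => (x + y) ^ k) (row q n) := by
  cases h : row q n with
  | nil => simp [row, h, nextRow, valueSumA, adjacentSum]
  | cons v l => simp [row, h, nextRow, valueSumA, adjacentSum, valueSumA_descendantsFrom]

/-- The new pairs of neighbours in terms of the old row. -/
theorem adjacentSum_row_succ {q k : ℕ} (hq : 5 ≤ q) {f : ℤ → ℤ → ℤ} (hf : f ∈ binaryForms k)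
    (n : ℕ) (hn : n = 0 → f 1 1 = 0) :
    adjacentSum f (row q (n + 1)) = adjacentSum (splitForm f) (row q n) +
      f 1 1 * ((q - 4) * (valueSum k (row q n) - 2) - valueSumA k (row q n)) := by
  cases n with
  | zero =>
    simp [row, nextRow, descendantsFrom, numDescendants, adjacentSum, adjacentSumFrom, hn rfl]
  | succ n =>
    obtain ⟨l, hl, h⟩ := exists_row_succ_eq q n
    rw [row, hl]
    cases l with
    | nil => exact h.elim
    | cons w l =>
      simp only [nextRow, descendantsFrom, numDescendants, adjacentSum, adjacentSumFrom,
        Nat.sub_self, List.replicate_zero, List.nil_append]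
      rw [adjacentSumFrom_descendantsFrom hq (apply_self_of_mem_binaryForms hf) _ _ _ h]
      have hs : valueSum k (⟨.winger, 1⟩ :: w :: l) = 1 + valueSum k (w :: l) := by
        simp [valueSum]
      have ha : valueSumA k (⟨.winger, 1⟩ :: w :: l) = valueSumA k (w :: l) := by
        simp [valueSumA]
      rw [hs, ha, splitForm]
      push_cast
      ring

theorem adjacentSumFrom_sub_sub (f g h : ℤ → ℤ → ℤ) (a b : ℤ) (x : ℕ) (l : List Vertex) :
    adjacentSumFrom (fun x y => f x y - a * g x y - b * h x y) x l =
      adjacentSumFrom f x l - a * adjacentSumFrom g x l - b * adjacentSumFrom h x l := by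
  induction l generalizing x with
  | nil => simp [adjacentSumFrom]
  | cons w l ih => simp only [adjacentSumFrom, ih]; ring

theorem adjacentSum_sub_sub (f g h : ℤ → ℤ → ℤ) (a b : ℤ) (l : List Vertex) :
    adjacentSum (fun x y => f x y - a * g x y - b * h x y) l =
      adjacentSum f l - a * adjacentSum g l - b * adjacentSum h l := by
  cases l with
  | nil => simp [adjacentSum]
  | cons v l => exact adjacentSumFrom_sub_sub ..

theorem adjacentSum_eq_zero {f : ℤ → ℤ → ℤ} (hf : ∀ x y, f x y = 0) (l : List Vertex) :
    adjacentSum f l = 0 := by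
  have (x : ℕ) (l : List Vertex) : adjacentSumFrom f x l = 0 := by
    induction l generalizing x with
    | nil => rfl
    | cons w l ih => rw [adjacentSumFrom, hf, ih, zero_add]
  cases l with
  | nil => rfl
  | cons v l => exact this ..

theorem natCast_powerSum (q k n : ℕ) : (powerSum q k n : ℤ) = valueSum k (row q n) := by
  have (l : List Vertex) : ∑ i ∈ Finset.range l.length, (l.map Vertex.value).getD i 0 ^ k =
      (l.map fun v => v.value ^ k).sum := by
    induction l with
    | nil => simp
    | cons v l ih => rw [List.length_cons, Finset.sum_range_succ']; simp [← ih, add_comm]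
  simp only [powerSum, rowSize, hbinom, this, valueSum]
  push_cast
  simp [Function.comp_def]

/-! ### Telescoping -/

/-- The list `(u_1, v_1), (u_2, v_2), …` drives the form `f` to zero. In the step of `(u, v)` the
value `f (1, 1)` has to be `2 * u`, and `f` is replaced by
`T f - p * (x + y) ^ k - (v + 4 * u) * (x ^ k + y ^ k)`, where `p` is the value at `(1, 1)` of the
form preceding `f` (initially `0`). The last form has to vanish at the points `(j, 1)` with `j ≤ k`, and the last
`p` has to be `0`. -/
def Terminates (k : ℕ) : (ℤ → ℤ → ℤ) → ℤ → List (ℤ × ℤ) → Prop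
  | f, p, [] => (∀ j < k + 1, f j 1 = 0) ∧ p = 0
  | f, p, c :: l => f 1 1 = 2 * c.1 ∧
      Terminates k
        (fun x y => splitForm f x y - p * (x + y) ^ k - (c.2 + 4 * c.1) * (x ^ k + y ^ k))
        (2 * c.1) l

theorem adjacentSum_telescope {q k : ℕ} (hq : 5 ≤ q) (l : List (ℤ × ℤ)) (f : ℤ → ℤ → ℤ) (p : ℤ)
    (hf : f ∈ binaryForms k) (h : Terminates k f p l) (m : ℕ) :
    adjacentSum f (row q (m + l.length)) - p * valueSumA k (row q (m + l.length)) =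
      2 * ∑ i ∈ Finset.range l.length, ((l.getD i 0).1 * q + (l.getD i 0).2) *
          valueSum k (row q (m + l.length - (i + 1))) -
        2 * (l.map Prod.snd).sum - 4 * (q - 2) * (l.map Prod.fst).sum := by
  induction l generalizing f p with
  | nil =>
    obtain ⟨hz, rfl⟩ := h
    simp [adjacentSum_eq_zero (eq_zero_of_mem_binaryForms hf hz)]
  | cons c l ih =>
    obtain ⟨h1, h⟩ := h
    have hmem : (fun x y => splitForm f x y - p * (x + y) ^ k -
        (c.2 + 4 * c.1) * (x ^ k + y ^ k)) ∈ binaryForms k :=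
      sub_mem (sub_mem (splitForm_mem_binaryForms hf)
          (Submodule.smul_mem _ p (sum_pow_mem_binaryForms k)))
        (Submodule.smul_mem _ (c.2 + 4 * c.1) (endForm_mem_binaryForms k))
    have ih := ih _ _ hmem h
    -- Row `0` is reached only in the last step, where `2 * c.1 = 0` is required.
    have hzero : m + l.length = 0 → f 1 1 = 0 := fun h0 => by
      obtain rfl : l = [] := List.length_eq_zero_iff.1 (by omega)
      exact h1.trans h.2
    rw [adjacentSum_sub_sub, adjacentSum_endForm, ← valueSumA_row_succ] at ih
    have hs (i : ℕ) : m + (l.length + 1) - (i + 1 + 1) = m + l.length - (i + 1) := by omega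
    rw [List.length_cons, Finset.sum_range_succ']
    simp only [List.getD_cons_succ, List.getD_cons_zero, hs, List.map_cons, List.sum_cons]
    rw [← add_assoc, adjacentSum_row_succ hq hf _ hzero, h1, zero_add, Nat.add_sub_cancel]
    linear_combination ih

/-! ### The table of coefficients -/

/-- The coefficients of the table: the pair `(u, v)` stands for `u * X + v`. -/
def coeffPairs : ℕ → List (ℤ × ℤ)
  | 0 => [(1, -1), (-1, 1), (0, 1)]
  | 1 => [(1, 0), (-1, -1), (0, 2)]
  | 2 => [(1, 2), (-1, -7), (0, 8), (0, -2)]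
  | 3 => [(1, 4), (1, -19), (-2, 18), (0, -2)]
  | 4 => [(1, 7), (6, -41), (-7, 31), (0, 6), (0, -2)]
  | 5 => [(1, 11), (18, -71), (-9, -17), (-10, 88), (0, -10)]
  | 6 => [(1, 17), (44, -99), (17, -303), (-62, 404), (0, -14), (0, -4)]
  | 7 => [(1, 26), (99, -68), (177, -1400), (-235, 1183), (-42, 302), (0, -42)]
  | 8 => [(1, 40), (213, 206), (757, -4842), (-717, 2981), (-254, 1782), (0, -162), (0, -4)]
  | 9 => [(1, 62), (447, 1288), (2433, -15116), (-2431, 10555), (-450, 3662), (0, -450), (0, 0)]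
  | 10 => [(1, 97), (924, 4782), (6096, -48560), (-13946, 75623), (5903, -24351), (1022, -8408),
      (0, 814), (0, 4)]
  | 11 => [(1, 153), (1892, 15110), (9924, -181164), (-99514, 592503), (78523, -360899),
      (9174, -74876), (0, 9174), (0, 0)]
  | _ => []

theorem coeffTable_eq_map {k : ℕ} (hk : k ≤ 11) :
    coeffTable k = (coeffPairs k).map fun c => C c.1 * X + C c.2 := by
  interval_cases k <;> simp [coeffTable, coeffPairs, sub_eq_add_neg]

theorem length_coeffPairs {k : ℕ} (hk : k ≤ 11) : (coeffPairs k).length = k / 2 + 3 := by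
  interval_cases k <;> rfl

theorem sum_fst_coeffPairs {k : ℕ} (hk : k ≤ 11) : ((coeffPairs k).map Prod.fst).sum = 0 := by
  interval_cases k <;> rfl

theorem sum_snd_coeffPairs {k : ℕ} (hk : k ≤ 11) : ((coeffPairs k).map Prod.snd).sum = 1 := by
  interval_cases k <;> rfl

theorem getD_coeffPairs_eq_zero_iff {k : ℕ} (hk : k ≤ 11) :
    (coeffPairs k).getD (k / 2 + 2) 0 = 0 ↔ k = 9 ∨ k = 11 := by
  interval_cases k <;> decide

theorem terminates_coeffPairs {k : ℕ} (hk : k ≤ 11) :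
    Terminates k (fun x y => x ^ k + y ^ k) 0 (coeffPairs k) := by
  interval_cases k <;> simp only [Terminates, coeffPairs] <;> decide +kernel

theorem tableCoeff_eq {k : ℕ} (hk : k ≤ 11) (i : ℕ) :
    tableCoeff k (i + 1) =
      C ((coeffPairs k).getD i 0).1 * X + C ((coeffPairs k).getD i 0).2 := by
  have := List.getD_map (l := coeffPairs k) (d := 0) (n := i) fun c : ℤ × ℤ => C c.1 * X + C c.2
  rw [tableCoeff, coeffTable_eq_map hk, Nat.add_sub_cancel, ← this]
  simp

end HyperbolicPascal

theorem mainTheorem3 (k : ℕ) (hk : k ≤ 11) :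
    (HyperbolicPascal.coeffTable k).length = k / 2 + 3 ∧
    (∀ j ∈ Finset.Icc 1 (k / 2 + 3), (HyperbolicPascal.tableCoeff k j).natDegree ≤ 1) ∧
    (HyperbolicPascal.tableCoeff k (k / 2 + 3) = 0 ↔ k = 9 ∨ k = 11) ∧
    ∀ q : ℕ, 5 ≤ q → ∀ n : ℕ, k / 2 + 3 ≤ n →
      (HyperbolicPascal.powerSum q k n : ℤ) =
        ∑ j ∈ Finset.Icc 1 (k / 2 + 3),
          (HyperbolicPascal.tableCoeff k j).eval (q : ℤ) *
            (HyperbolicPascal.powerSum q k (n - j) : ℤ) := by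
  open HyperbolicPascal in
  refine ⟨?_, fun j hj => ?_, ?_, fun q hq n hn => ?_⟩
  · rw [coeffTable_eq_map hk, List.length_map, length_coeffPairs hk]
  · obtain ⟨i, rfl⟩ := Nat.exists_eq_add_of_le' (Finset.mem_Icc.1 hj).1
    rw [tableCoeff_eq hk]
    exact natDegree_linear_le
  · rw [← getD_coeffPairs_eq_zero_iff hk, tableCoeff_eq hk]
    refine ⟨fun h => Prod.ext ?_ ?_, fun h => by rw [h]; simp⟩
    · simpa only [coeff_add, coeff_C_mul, coeff_X_one, mul_one, coeff_C_succ, add_zero,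
        coeff_zero, Prod.fst_zero] using congrArg (coeff · 1) h
    · simpa only [coeff_add, coeff_C_mul, coeff_X_zero, mul_zero, coeff_C_zero, zero_add,
        coeff_zero, Prod.snd_zero] using congrArg (coeff · 0) h
  · obtain ⟨m, rfl⟩ := Nat.exists_eq_add_of_le' hn
    have h := adjacentSum_telescope hq _ _ _ (endForm_mem_binaryForms k)
      (terminates_coeffPairs hk) m
    rw [adjacentSum_endForm, sum_fst_coeffPairs hk, sum_snd_coeffPairs hk,
      length_coeffPairs hk] at h
    rw [← Finset.Ico_add_one_right_eq_Icc, Finset.sum_Ico_eq_sum_range]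
    simp only [Nat.add_sub_cancel, add_comm 1, tableCoeff_eq hk, natCast_powerSum, eval_add,
      eval_mul, eval_C, eval_X]
    linarith
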